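/- Let $\xi_1,\xi_2,\dots$ be i.i.d. real random variables with common distribution $F$, and put $\overline F(x)=\mathbf P(\xi_1>x)$, $S_0=0$, $S_n=\xi_1+\dots+\xi_n$. Let $\tau=\inf\{n\ge 1:S_n<0\}$ or $\tau=\inf\{n\ge1:S_n\le 0\}$ (the statement holds for each of the two), with $\inf\emptyset=\infty$, and let $M_\tau=\sup\{S_i: i\in\mathbb Z_{\ge0},\ i\le\tau\}$. Then: (i) With no further assumption, for every $c<\mathbf E\tau\in[1,\infty]$, $c\ge 0$, the inequality $\mathbf P(M_\tau>x)\ge c\,\overline F(x)$ holds for all sufficiently large $x$. (ii) Suppose that $S_n\to-\infty$ almost surely. Let $\eta=\inf\{n\ge1:S_n>0\}$ be the first strict ascending ladder epoch and let $G_+(B)=\mathbf P(S_\eta\in B\mid\eta<\infty)$ be the ladder-height distribution. If $G_+\in\mathcal S_F$, then $\mathbf E\tau<\infty$ and $$\mathbf P(M_\tau>x)\sim\mathbf E\tau\,\overline F(x),\qquad x\to\infty.$$ Here a probability distribution $G$ on $[0,\infty)$ belongs to $\mathcal S_F$ if $\overline F(x)>0$ for all $x$ and $\int_{[0,x]}\overline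 F(x-u)\,G(du)\sim\overline F(x)$ as $x\to\infty$. -/

import Mathlib

open Filter MeasureTheory ProbabilityTheory Topology
open scoped ENNReal Asymptotics

noncomputable section

namespace RandomWalk

/-- The tail `F̄(x) = F(x, ∞)` of a distribution `F` on the real line. -/
def tail (F : Measure ℝ) (x : ℝ) : ℝ := F.real (Set.Ioi x)

/-- The class `S_F`: the distribution `G` is a probability distribution on `[0, ∞)`, the tail of `F`
never vanishes, and `∫_{[0,x]} F̄(x - u) G(du) ∼ F̄(x)` as `x → ∞`. -/
structure MemSF (F G : Measure ℝ) : Prop where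
  isProbabilityMeasure : IsProbabilityMeasure G
  nonneg : G (Set.Iio 0) = 0
  tail_pos : ∀ x : ℝ, 0 < tail F x
  isEquivalent :
    (fun x : ℝ => ∫ u in Set.Icc 0 x, tail F (x - u) ∂G) ~[atTop] (fun x : ℝ => tail F x)

variable {Ω : Type*}

/-- The random walk `S_0 = 0`, `S_n = ξ_1 + ⋯ + ξ_n`; the step `ξ_{i+1}` is `ξ i`. -/
def walk (ξ : ℕ → Ω → ℝ) (n : ℕ) (ω : Ω) : ℝ := ∑ i ∈ Finset.range n, ξ i ω

/-- `inf {n ≥ 1 : S_n ∈ A}`, with value `∞` if there is no such `n`. -/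
def entranceTime (ξ : ℕ → Ω → ℝ) (A : Set ℝ) (ω : Ω) : ℕ∞ :=
  ⨅ (n : ℕ) (_ : 1 ≤ n ∧ walk ξ n ω ∈ A), (n : ℕ∞)

/-- `sup {S_i : 0 ≤ i ≤ T}` for a random time `T`; it is a maximum wherever `T` is finite. -/
def maxUpTo (ξ : ℕ → Ω → ℝ) (T : Ω → ℕ∞) (ω : Ω) : EReal :=
  ⨆ (i : ℕ) (_ : (i : ℕ∞) ≤ T ω), (walk ξ i ω : EReal)

variable [MeasurableSpace Ω]

/-- The expectation of a random time, as an element of `[0, ∞]`. -/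
def meanTime (P : Measure Ω) (T : Ω → ℕ∞) : ℝ≥0∞ := ∫⁻ ω, (T ω : ℝ≥0∞) ∂P

/-- The first strict ascending ladder epoch `η = inf {n ≥ 1 : S_n > 0}`. -/
def ladderEpoch (ξ : ℕ → Ω → ℝ) : Ω → ℕ∞ := entranceTime ξ (Set.Ioi 0)

/-- The ladder-height distribution `G_+(B) = P(S_η ∈ B | η < ∞)`. -/
def ladderHeightLaw (P : Measure Ω) (ξ : ℕ → Ω → ℝ) : Measure ℝ :=
  (ProbabilityTheory.cond P {ω | ladderEpoch ξ ω < ⊤}).map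
    (fun ω => walk ξ (ladderEpoch ξ ω).toNat ω)

end RandomWalk

end

/-!
The walk exceeds a high level before time `τ` by a single big step. Write `A` for the entrance set
of `τ` and `F̄` for the tail of `F`.

*Lower bound.* The events "`τ > n`, the walk has stayed below `x` up to time `n`, and step `n + 1`
exceeds `x`" are disjoint and force the maximum above `x`, because `S_n ≥ 0` while `τ > n`. Their
probabilities are `P(τ > n, max_{k ≤ n} S_k ≤ x) F̄(x)`, and finitely many terms of
`∑ P(τ > n) = E τ` already exceed `c` (`eventually_mul_le_measure_lt_maxUpTo`).

*Upper bound.* The first passage above `x` comes from some position `u ≤ x` occupied before `τ`, so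
`P(M_τ > x) ≤ h(x) = ∑ n, E[F̄(x - S_n); τ > n, S_n ≤ x]` (`measure_lt_maxUpTo_le`). Reversing time
turns `τ > n` into "`n` is an ascending ladder epoch", weak or strict according to `A`
(`tsum_lintegral_survival`). Hence `h` is an integral against the renewal measure of the ladder
heights, whose total mass is `m = E τ`. Splitting at the first strict ladder epoch gives, with
`p = P(η < ∞)`, the renewal equation `h(x) = (1 - p) m F̄(x) + p ∫_{[0,x]} h(x - v) G₊(dv)`
(`renewalIntegral_eq`, `renewalIntegral_overshoot_toReal_le`). Splitting at the last ladder epoch,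
which exists since the walk drifts to `-∞`, gives `m < ∞` and `p < 1` (`tsum_record_mul_stay`).

If `G₊ ∈ S_F`, then `∫_{[0,x]} F̄(x - v) G₊(dv) ∼ F̄(x)`, and the part of this integral with `x - v`
bounded is negligible. The equation therefore first bounds `h / F̄` and then shows that
`L = limsup h / F̄` satisfies `L ≤ (1 - p) m + p L`, that is, `L ≤ m`
(`eventually_le_mul_of_renewal`). No convolution powers of `G₊` are needed.
-/

namespace RandomWalk

/-! ### Independence and exchangeability of the steps -/

/-- The law of a sequence of independent variables with common distribution `F`, on the path space
`ℕ → ℝ`. -/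
noncomputable def pathLaw (F : Measure ℝ) : Measure (ℕ → ℝ) := Measure.infinitePi fun _ => F

/-- The coordinate process on the path space. -/
def coord (n : ℕ) (x : ℕ → ℝ) : ℝ := x n

/-- The path `x` with all steps from the `n`-th on replaced by `0`. -/
def stopAt (n : ℕ) (x : ℕ → ℝ) : ℕ → ℝ := fun i => if i < n then x i else 0

/-- The path `x` with its first `n` steps deleted. -/
def shift (n : ℕ) (x : ℕ → ℝ) : ℕ → ℝ := fun i => x (n + i)

/-- The path `x` with its first `n` steps in reversed order. -/
def reverse (n : ℕ) (x : ℕ → ℝ) : ℕ → ℝ := fun i => x (if i < n then n - 1 - i else i)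

@[fun_prop]
lemma measurable_coord (n : ℕ) : Measurable (coord n) := measurable_pi_apply n

@[fun_prop]
lemma measurable_walk_coord (n : ℕ) : Measurable (walk coord n) := by
  unfold walk; fun_prop

@[fun_prop]
lemma measurable_shift (n : ℕ) : Measurable (shift n) := by
  unfold shift; fun_prop

@[fun_prop]
lemma measurable_reverse (n : ℕ) : Measurable (reverse n) := by
  unfold reverse; fun_prop

section Law

variable {F : Measure ℝ} [IsProbabilityMeasure F]

instance : IsProbabilityMeasure (pathLaw F) := by
  unfold pathLaw; infer_instance

lemma map_eval_pathLaw (n : ℕ) : (pathLaw F).map (fun x => x n) = F :=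
  Measure.infinitePi_map_eval _ n

/-- A sequence of i.i.d. variables keeps its law when it is reindexed along an injection. -/
lemma map_reindex_pathLaw {e : ℕ → ℕ} (he : Function.Injective e) :
    (pathLaw F).map (fun x i => x (e i)) = pathLaw F :=
  Measure.map_infinitePi_infinitePi_of_inj he

lemma map_shift_pathLaw (n : ℕ) : (pathLaw F).map (shift n) = pathLaw F :=
  map_reindex_pathLaw (add_right_injective n)

lemma lintegral_reverse (n : ℕ) {φ : (ℕ → ℝ) → ℝ≥0∞} (hφ : Measurable φ) :
    ∫⁻ x, φ (reverse n x) ∂pathLaw F = ∫⁻ x, φ x ∂pathLaw F := by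
  have he : Function.Injective fun i : ℕ => if i < n then n - 1 - i else i := by
    intro i j hij
    simp only at hij
    split_ifs at hij <;> omega
  have h : (pathLaw F).map (reverse n) = pathLaw F := map_reindex_pathLaw he
  conv_rhs => rw [← h]
  rw [lintegral_map hφ (by fun_prop)]

lemma indepFun_stopAt_shift (n : ℕ) : IndepFun (stopAt n) (shift n) (pathLaw F) := by
  have hi : iIndepFun (fun (i : ℕ) (x : ℕ → ℝ) => x i) (pathLaw F) :=
    iIndepFun_infinitePi (X := fun _ y => y) (by fun_prop)
  have key := indep_iSup_of_disjoint (fun i => (measurable_pi_apply i).comap_le) hi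
    (S := {i | i < n}) (T := {i | n ≤ i})
    (Set.disjoint_left.2 fun i (h : i < n) (h' : n ≤ i) => absurd h h'.not_gt)
  refine indep_of_indep_of_le_left (indep_of_indep_of_le_right key ?_) ?_
  · rw [MeasurableSpace.pi, MeasurableSpace.comap_iSup]
    refine iSup_le fun i => ?_
    rw [MeasurableSpace.comap_comp]
    exact le_iSup₂_of_le (n + i) (Nat.le_add_right n i) le_rfl
  · rw [MeasurableSpace.pi, MeasurableSpace.comap_iSup]
    refine iSup_le fun i => ?_
    rw [MeasurableSpace.comap_comp]
    by_cases h : i < n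
    · simp only [stopAt, h, if_true, Function.comp_def]
      exact le_iSup₂_of_le i h le_rfl
    · simp only [stopAt, h, if_false, Function.comp_def, MeasurableSpace.comap_const, bot_le]

/-- The Markov property at the fixed time `n`: given the first `n` steps, the remaining ones form an
independent copy of the whole path. -/
lemma lintegral_markov (n : ℕ) {Φ : (ℕ → ℝ) → (ℕ → ℝ) → ℝ≥0∞}
    (hΦ : Measurable (Function.uncurry Φ)) (hn : ∀ x y, Φ (stopAt n x) y = Φ x y) :
    ∫⁻ x, Φ x (shift n x) ∂pathLaw F = ∫⁻ x, ∫⁻ y, Φ x y ∂pathLaw F ∂pathLaw F := by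
  have hm : Measurable (stopAt n) := by
    refine measurable_pi_iff.2 fun i => ?_
    unfold stopAt
    split_ifs <;> fun_prop
  have h := (indepFun_iff_map_prod_eq_prod_map_map hm.aemeasurable
    (measurable_shift n).aemeasurable).1 (indepFun_stopAt_shift (F := F) n)
  rw [map_shift_pathLaw] at h
  have : IsProbabilityMeasure ((pathLaw F).map (stopAt n)) :=
    Measure.isProbabilityMeasure_map hm.aemeasurable
  calc ∫⁻ x, Φ x (shift n x) ∂pathLaw F
      = ∫⁻ x, Function.uncurry Φ (stopAt n x, shift n x) ∂pathLaw F := by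
        simp [Function.uncurry, hn]
    _ = ∫⁻ z, Function.uncurry Φ z ∂((pathLaw F).map (stopAt n)).prod (pathLaw F) := by
        rw [← h, lintegral_map hΦ (hm.prodMk (by fun_prop))]
    _ = ∫⁻ x, ∫⁻ y, Φ (stopAt n x) y ∂pathLaw F ∂pathLaw F := by
        rw [lintegral_prod _ hΦ.aemeasurable, lintegral_map hΦ.lintegral_prod_right' hm]
        rfl
    _ = _ := by simp only [hn]

end Law

/-! ### Survival, record times and time reversal -/

/-- The paths whose partial sums avoid `A` at the times `1, …, n`. -/
def survival (A : Set ℝ) (n : ℕ) : Set (ℕ → ℝ) :=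
  {x | ∀ k, 1 ≤ k → k ≤ n → walk coord k x ∉ A}

/-- The paths for which `n` is a record time: no increment `S_n - S_k` with `k < n` lies in `A`. For
`A = (-∞, 0)` these are the weak ascending ladder epochs, for `A = (-∞, 0]` the strict ones, and
`n = 0` is one of them in both cases. -/
def record (A : Set ℝ) (n : ℕ) : Set (ℕ → ℝ) :=
  {x | ∀ k < n, walk coord n x - walk coord k x ∉ A}

/-- The paths that enter `A` for the first time at time `n ≥ 1`. -/
def firstEntrance (A : Set ℝ) (n : ℕ) : Set (ℕ → ℝ) :=
  {x | 1 ≤ n ∧ walk coord n x ∈ A ∧ ∀ k, 1 ≤ k → k < n → walk coord k x ∉ A}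

/-- The paths that stay in `A` at all times `k ≥ 1`. -/
def stay (A : Set ℝ) : Set (ℕ → ℝ) := {x | ∀ k, 1 ≤ k → walk coord k x ∈ A}

section Walk

variable {Ω : Type*} {ξ : ℕ → Ω → ℝ} {A : Set ℝ}

lemma walk_zero (ξ : ℕ → Ω → ℝ) (ω : Ω) : walk ξ 0 ω = 0 := by simp [walk]

lemma walk_succ (ξ : ℕ → Ω → ℝ) (n : ℕ) (ω : Ω) : walk ξ (n + 1) ω = walk ξ n ω + ξ n ω := by
  simp [walk, Finset.sum_range_succ]

lemma lt_entranceTime_iff {n : ℕ} {ω : Ω} :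
    (n : ℕ∞) < entranceTime ξ A ω ↔ ∀ k, 1 ≤ k → k ≤ n → walk ξ k ω ∉ A := by
  constructor
  · intro h k hk hkn hA
    have : entranceTime ξ A ω ≤ k := iInf₂_le k ⟨hk, hA⟩
    exact absurd (h.trans_le this) (by simpa using hkn)
  · intro h
    have : ((n + 1 : ℕ) : ℕ∞) ≤ entranceTime ξ A ω := by
      refine le_iInf₂ fun k hk => ?_
      by_contra hc
      exact h k hk.1 (by simp only [not_le, Nat.cast_lt] at hc; omega) hk.2
    exact lt_of_lt_of_le (by exact_mod_cast Nat.lt_succ_self n) this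

lemma entranceTime_eq_iff {n : ℕ} {ω : Ω} :
    entranceTime ξ A ω = n ↔
      1 ≤ n ∧ walk ξ n ω ∈ A ∧ ∀ k, 1 ≤ k → k < n → walk ξ k ω ∉ A := by
  constructor
  · intro h
    have hlt : ∀ k, 1 ≤ k → k < n → walk ξ k ω ∉ A := fun k hk hkn =>
      lt_entranceTime_iff.1 (by rw [h]; exact_mod_cast hkn) k hk le_rfl
    have h0 : ((0 : ℕ) : ℕ∞) < entranceTime ξ A ω :=
      lt_entranceTime_iff.2 fun k hk hk0 => by omega
    have h1 : 1 ≤ n := by rw [h] at h0; exact_mod_cast h0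
    refine ⟨h1, ?_, hlt⟩
    by_contra hc
    have : (n : ℕ∞) < entranceTime ξ A ω := lt_entranceTime_iff.2 fun k hk hkn => by
      rcases hkn.lt_or_eq with hkn | rfl
      · exact hlt k hk hkn
      · exact hc
    exact this.ne' h
  · rintro ⟨h1, hA, hlt⟩
    refine le_antisymm (iInf₂_le n ⟨h1, hA⟩) (le_iInf₂ fun k hk => ?_)
    by_contra hc
    exact hlt k hk.1 (by simpa using hc) hk.2

lemma mem_survival_iff {n : ℕ} {x : ℕ → ℝ} :
    x ∈ survival A n ↔ (n : ℕ∞) < entranceTime coord A x := lt_entranceTime_iff.symm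

lemma mem_firstEntrance_iff {n : ℕ} {x : ℕ → ℝ} :
    x ∈ firstEntrance A n ↔ entranceTime coord A x = n := entranceTime_eq_iff.symm

lemma entranceTime_lt_top_iff {x : ℕ → ℝ} :
    entranceTime coord A x < ⊤ ↔ ∃ n, x ∈ firstEntrance A n := by
  simp only [mem_firstEntrance_iff, lt_top_iff_ne_top, ENat.ne_top_iff_exists, eq_comm]

lemma lt_maxUpTo_iff {T : Ω → ℕ∞} {ω : Ω} {x : ℝ} :
    (x : EReal) < maxUpTo ξ T ω ↔ ∃ i : ℕ, (i : ℕ∞) ≤ T ω ∧ x < walk ξ i ω := by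
  simp [maxUpTo, lt_iSup_iff]

lemma walk_stopAt {k n : ℕ} (h : k ≤ n) (x : ℕ → ℝ) :
    walk coord k (stopAt n x) = walk coord k x :=
  Finset.sum_congr rfl fun i hi => by
    simp [coord, stopAt, (Finset.mem_range.1 hi).trans_le h]

lemma walk_shift (k n : ℕ) (x : ℕ → ℝ) :
    walk coord k (shift n x) = walk coord (n + k) x - walk coord n x := by
  simp [walk, coord, shift, Finset.sum_range_add]

lemma walk_reverse {k n : ℕ} (h : k ≤ n) (x : ℕ → ℝ) :
    walk coord k (reverse n x) = walk coord n x - walk coord (n - k) x := by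
  induction k with
  | zero => simp [walk_zero]
  | succ k ih =>
    have e : n - k = n - (k + 1) + 1 := by omega
    rw [walk_succ, ih (by omega), e, walk_succ]
    have : n - 1 - k = n - (k + 1) := by omega
    simp only [coord, reverse, show k < n by omega, if_true, this]
    ring

/-- Reversing the first `n` steps turns survival up to time `n` into `n` being a record time. -/
lemma reverse_mem_survival_iff {n : ℕ} {x : ℕ → ℝ} :
    reverse n x ∈ survival A n ↔ x ∈ record A n := by
  constructor
  · intro h k hk
    have := h (n - k) (by omega) (by omega)
    rwa [walk_reverse (by omega), show n - (n - k) = k by omega] at this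
  · intro h k hk hkn
    rw [walk_reverse hkn]
    exact h (n - k) (by omega)

lemma stopAt_mem_survival_iff {n : ℕ} {x : ℕ → ℝ} :
    stopAt n x ∈ survival A n ↔ x ∈ survival A n :=
  forall₃_congr fun k _ hkn => by rw [walk_stopAt hkn]

lemma stopAt_mem_record_iff {n : ℕ} {x : ℕ → ℝ} :
    stopAt n x ∈ record A n ↔ x ∈ record A n :=
  forall₂_congr fun k hk => by rw [walk_stopAt le_rfl, walk_stopAt hk.le]

lemma stopAt_mem_firstEntrance_iff {n : ℕ} {x : ℕ → ℝ} :
    stopAt n x ∈ firstEntrance A n ↔ x ∈ firstEntrance A n := by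
  refine and_congr Iff.rfl (and_congr (by rw [walk_stopAt le_rfl]) ?_)
  exact forall₃_congr fun k _ hkn => by rw [walk_stopAt hkn.le]

lemma measurableSet_survival (hA : MeasurableSet A) (n : ℕ) : MeasurableSet (survival A n) := by
  simp only [survival, Set.ofPred_forall]
  exact .iInter fun k => .iInter fun _ => .iInter fun _ => (measurable_walk_coord k hA).compl

lemma measurableSet_record (hA : MeasurableSet A) (n : ℕ) : MeasurableSet (record A n) := by
  simp only [record, Set.ofPred_forall]
  exact .iInter fun k => .iInter fun _ =>
    (((measurable_walk_coord n).sub (measurable_walk_coord k)) hA).compl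

lemma measurableSet_stay (hA : MeasurableSet A) : MeasurableSet (stay A) := by
  simp only [stay, Set.ofPred_forall]
  exact .iInter fun k => .iInter fun _ => measurable_walk_coord k hA

lemma measurable_entranceTime (hA : MeasurableSet A) : Measurable (entranceTime coord A) := by
  refine ENat.measurable_iff.2 fun n => ?_
  have : entranceTime coord A ⁻¹' {(n : ℕ∞)} = firstEntrance A n := by
    ext x; exact mem_firstEntrance_iff.symm
  rw [this]
  have hw := measurable_walk_coord
  have h : MeasurableSet {x | ∀ k, 1 ≤ k → k < n → walk coord k x ∉ A} := by
    simp only [Set.ofPred_forall]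
    exact .iInter fun k => .iInter fun _ => .iInter fun _ => (hw k hA).compl
  exact (MeasurableSet.const (1 ≤ n)).inter ((hw n hA).inter h)

lemma measurableSet_firstEntrance (hA : MeasurableSet A) (n : ℕ) :
    MeasurableSet (firstEntrance A n) := by
  have : firstEntrance A n = entranceTime coord A ⁻¹' {(n : ℕ∞)} := by
    ext x; exact mem_firstEntrance_iff
  rw [this]
  exact measurable_entranceTime hA (MeasurableSet.singleton _)

lemma measurable_walk_entranceTime (hA : MeasurableSet A) :
    Measurable fun x => walk coord (entranceTime coord A x).toNat x :=
  (measurable_from_prod_countable_right (f := fun z : ℕ × (ℕ → ℝ) => walk coord z.1 z.2)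
    measurable_walk_coord).comp
    (((measurable_of_countable ENat.toNat).comp (measurable_entranceTime hA)).prodMk
      measurable_id)

end Walk

/-- `∑ n, E[φ(S_n); n is a record time]`: the integral of `φ` against the renewal measure of the
ladder heights. -/
noncomputable def renewalIntegral (F : Measure ℝ) (A : Set ℝ) (φ : ℝ → ℝ≥0∞) : ℝ≥0∞ :=
  ∑' n, ∫⁻ x in record A n, φ (walk coord n x) ∂pathLaw F

section Duality

variable {F : Measure ℝ} {A : Set ℝ}

/-- Duality: the occupation measure of the walk before it enters `A` is the renewal measure of its
ladder heights. -/
lemma tsum_lintegral_survival [IsProbabilityMeasure F] (hA : MeasurableSet A)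
    {φ : ℝ → ℝ≥0∞} (hφ : Measurable φ) :
    ∑' n, ∫⁻ x in survival A n, φ (walk coord n x) ∂pathLaw F = renewalIntegral F A φ := by
  refine tsum_congr fun n => ?_
  rw [← lintegral_indicator (measurableSet_survival hA n),
    ← lintegral_indicator (measurableSet_record hA n),
    ← lintegral_reverse n (Measurable.indicator (by fun_prop) (measurableSet_survival hA n))]
  refine lintegral_congr fun x => ?_
  by_cases h : x ∈ record A n
  · simp [h, reverse_mem_survival_iff.2 h, walk_reverse, walk_zero]
  · simp [h, mt reverse_mem_survival_iff.1 h]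

lemma _root_.ENat.toENNReal_eq_tsum (N : ℕ∞) :
    (N : ℝ≥0∞) = ∑' n : ℕ, if (n : ℕ∞) < N then 1 else 0 := by
  induction N with
  | top => simp
  | coe k =>
    rw [tsum_eq_sum (s := Finset.range k) (fun n hn => by simpa using hn),
      Finset.sum_congr rfl (g := fun _ => 1) (fun n hn => by simpa using hn)]
    simp

lemma meanTime_entranceTime (hA : MeasurableSet A) :
    meanTime (pathLaw F) (entranceTime coord A) = ∑' n, pathLaw F (survival A n) := by
  have h : ∀ x : ℕ → ℝ, (entranceTime coord A x : ℝ≥0∞)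
      = ∑' n, (survival A n).indicator 1 x := fun x => by
    rw [ENat.toENNReal_eq_tsum]
    exact tsum_congr fun n => by simp [Set.indicator, mem_survival_iff]
  simp only [meanTime, h]
  rw [lintegral_tsum fun n =>
    (measurable_one.indicator (measurableSet_survival hA n)).aemeasurable]
  exact tsum_congr fun n => lintegral_indicator_one (measurableSet_survival hA n)

lemma meanTime_eq_renewalIntegral [IsProbabilityMeasure F] (hA : MeasurableSet A) :
    meanTime (pathLaw F) (entranceTime coord A) = renewalIntegral F A fun _ => 1 := by
  rw [meanTime_entranceTime hA, ← tsum_lintegral_survival hA measurable_const]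
  simp

lemma renewalIntegral_one : renewalIntegral F A (fun _ => 1) = ∑' n, pathLaw F (record A n) := by
  simp [renewalIntegral]

end Duality

/-! ### Finiteness of the renewal mass and the renewal equation -/

section Renewal

variable {F : Measure ℝ} {A : Set ℝ}

lemma measurableSet_of_halfLine (hA : A = Set.Iio 0 ∨ A = Set.Iic 0) : MeasurableSet A := by
  rcases hA with rfl | rfl <;> measurability

lemma nonneg_of_mem_record (hA : A = Set.Iio 0 ∨ A = Set.Iic 0) {n : ℕ} {x : ℕ → ℝ}
    (hx : x ∈ record A n) : 0 ≤ walk coord n x := by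
  rcases n.eq_zero_or_pos with rfl | hn
  · rw [walk_zero]
  · have := hx 0 hn
    rw [walk_zero, sub_zero] at this
    rcases hA with rfl | rfl
    · simpa using this
    · exact (not_le.1 this).le

/-- A walk drifting to `-∞` has a last record time, after which its increments stay in `A`. -/
lemma exists_record_stay (hA : A = Set.Iio 0 ∨ A = Set.Iic 0) {x : ℕ → ℝ}
    (hx : Tendsto (fun n => walk coord n x) atTop atBot) :
    ∃ n, x ∈ record A n ∧ shift n x ∈ stay A := by
  classical
  obtain ⟨N, hN⟩ := eventually_atTop.1 (hx.eventually (eventually_lt_atBot 0))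
  have hbd : ∀ n, x ∈ record A n → n ≤ N := fun n hn => by
    by_contra hc
    exact (hN n (by omega)).not_ge (nonneg_of_mem_record hA hn)
  have h0 : x ∈ record A 0 := fun k hk => absurd hk k.not_lt_zero
  obtain ⟨hn, hmax⟩ : x ∈ record A (Nat.findGreatest (x ∈ record A ·) N) ∧
      ∀ m, Nat.findGreatest (x ∈ record A ·) N < m → x ∉ record A m :=
    ⟨Nat.findGreatest_spec (P := (x ∈ record A ·)) (Nat.zero_le N) h0, fun m hm hmr =>
      Nat.findGreatest_is_greatest hm (hbd m hmr) hmr⟩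
  set n := Nat.findGreatest (x ∈ record A ·) N
  refine ⟨n, hn, ?_⟩
  by_contra hs
  -- the first time after `n` at which the increment from `n` leaves `A` would be a later record
  have hex : ∃ k, 1 ≤ k ∧ walk coord k (shift n x) ∉ A := by
    simpa [stay] using hs
  obtain ⟨hk1, hkA⟩ := Nat.find_spec hex
  have hmin : ∀ j < Nat.find hex, 1 ≤ j → walk coord j (shift n x) ∈ A := fun j hj hj1 => by
    by_contra hc
    exact Nat.find_min hex hj ⟨hj1, hc⟩
  set k := Nat.find hex
  refine hmax (n + k) (by omega) fun j hj => ?_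
  rw [walk_shift] at hkA
  rcases lt_trichotomy j n with h | rfl | h
  · have := hn j h
    rcases hA with rfl | rfl
    · simp only [Set.mem_Iio, not_lt] at *; linarith
    · simp only [Set.mem_Iic, not_le] at *; linarith
  · exact hkA
  · have := hmin (j - n) (by omega) (by omega)
    rw [walk_shift, show n + (j - n) = j by omega] at this
    rcases hA with rfl | rfl
    · simp only [Set.mem_Iio, not_lt] at *; linarith
    · simp only [Set.mem_Iic, not_le] at *; linarith

/-- Decomposition of the path at its last record time: for a walk drifting to `-∞` the expected
number of record times and the probability that there is none after time `0` are inverse to each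
other. In particular the former is finite and the latter positive. -/
lemma tsum_record_mul_stay [IsProbabilityMeasure F] (hA : A = Set.Iio 0 ∨ A = Set.Iic 0)
    (hdrift : ∀ᵐ x ∂pathLaw F, Tendsto (fun n => walk coord n x) atTop atBot) :
    (∑' n, pathLaw F (record A n)) * pathLaw F (stay A) = 1 := by
  have hm := measurableSet_of_halfLine hA
  have hE : ∀ n, MeasurableSet (record A n ∩ shift n ⁻¹' stay A) := fun n =>
    (measurableSet_record hm n).inter (measurable_shift n (measurableSet_stay hm))
  have hprod : ∀ n, pathLaw F (record A n) * pathLaw F (stay A)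
      = pathLaw F (record A n ∩ shift n ⁻¹' stay A) := fun n => by
    have h := lintegral_markov (F := F) n
      (Φ := fun x y => (record A n).indicator 1 x * (stay A).indicator 1 y)
      (((measurable_one.indicator (measurableSet_record hm n)).comp measurable_fst).mul
        ((measurable_one.indicator (measurableSet_stay hm)).comp measurable_snd))
      (fun x y => by
        by_cases h : x ∈ record A n
        · simp [h, stopAt_mem_record_iff.2 h]
        · simp [h, mt stopAt_mem_record_iff.1 h])
    simp only [lintegral_const_mul _ (measurable_one.indicator (measurableSet_stay hm)),
      lintegral_mul_const _ (measurable_one.indicator (measurableSet_record hm n)),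
      lintegral_indicator_one (measurableSet_stay hm),
      lintegral_indicator_one (measurableSet_record hm n)] at h
    rw [← h, ← lintegral_indicator_one (hE n)]
    refine lintegral_congr fun x => ?_
    by_cases h1 : x ∈ record A n <;> by_cases h2 : shift n x ∈ stay A <;> simp [h1, h2]
  have hdisj : Pairwise (Function.onFun Disjoint fun n => record A n ∩ shift n ⁻¹' stay A) := by
    refine (pairwise_disjoint_on _).2 fun m n hmn => Set.disjoint_left.2 ?_
    rintro x ⟨-, hx⟩ ⟨hx', -⟩
    have := hx (n - m) (by omega)
    rw [walk_shift, show m + (n - m) = n by omega] at this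
    exact hx' m hmn this
  rw [← ENNReal.tsum_mul_right, tsum_congr hprod, ← measure_iUnion hdisj hE]
  refine prob_compl_eq_zero_iff (MeasurableSet.iUnion hE) |>.1 (measure_eq_zero_iff_ae_notMem.2 ?_)
  filter_upwards [hdrift] with x hx
  simpa using exists_record_stay hA hx

lemma renewalIntegral_one_ne_top [IsProbabilityMeasure F] (hA : A = Set.Iio 0 ∨ A = Set.Iic 0)
    (hdrift : ∀ᵐ x ∂pathLaw F, Tendsto (fun n => walk coord n x) atTop atBot) :
    renewalIntegral F A (fun _ => 1) ≠ ⊤ := by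
  intro h
  have h1 := tsum_record_mul_stay hA hdrift
  rw [← renewalIntegral_one, h] at h1
  have h2 : pathLaw F (stay A) ≠ 0 := fun h0 => by simp [h0] at h1
  simp [ENNReal.top_mul h2] at h1

lemma prob_ladderEpoch_lt_one [IsProbabilityMeasure F]
    (hdrift : ∀ᵐ x ∂pathLaw F, Tendsto (fun n => walk coord n x) atTop atBot) :
    pathLaw F {x | ladderEpoch coord x < ⊤} < 1 := by
  have h1 := tsum_record_mul_stay (A := Set.Iic 0) (.inr rfl) hdrift
  have hm : MeasurableSet (stay (Set.Iic (0 : ℝ))) := measurableSet_stay measurableSet_Iic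
  have h2 : pathLaw F (stay (Set.Iic 0)) ≠ 0 := fun h0 => by simp [h0] at h1
  have h3 : {x | ladderEpoch coord x < ⊤} ⊆ (stay (Set.Iic (0 : ℝ)))ᶜ := by
    intro x hx hs
    obtain ⟨n, hn1, hn, -⟩ := entranceTime_lt_top_iff.1 hx
    exact not_lt_of_ge (Set.mem_Iic.1 (hs n hn1)) (Set.mem_Ioi.1 hn)
  refine (measure_mono h3).trans_lt ?_
  rw [prob_compl_eq_one_sub hm]
  exact ENNReal.sub_lt_self ENNReal.one_ne_top one_ne_zero h2

/-- Pathwise form of the renewal equation: a record time `n` either precedes the first strict ladder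
epoch, and then `S_n = 0`, or it is a record time of the path restarted at that epoch. -/
lemma indicator_record_eq (hA : A = Set.Iio 0 ∨ A = Set.Iic 0) (φ : ℝ → ℝ≥0∞) (n : ℕ)
    (x : ℕ → ℝ) :
    (record A n).indicator (fun x => φ (walk coord n x)) x
      = (record A n ∩ survival (Set.Ioi 0) n).indicator (fun _ => φ 0) x
        + ∑ mk ∈ Finset.HasAntidiagonal.antidiagonal n,
          (firstEntrance (Set.Ioi 0) mk.1).indicator (fun x =>
            (record A mk.2).indicator (fun y => φ (walk coord mk.1 x + walk coord mk.2 y))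
              (shift mk.1 x)) x := by
  by_cases hs : x ∈ survival (Set.Ioi 0) n
  · have h0 : ∀ mk ∈ Finset.HasAntidiagonal.antidiagonal n, x ∉ firstEntrance (Set.Ioi 0) mk.1 :=
      fun mk hmk h => by
        rw [Finset.HasAntidiagonal.mem_antidiagonal] at hmk
        exact hs mk.1 h.1 (by omega) h.2.1
    rw [Finset.sum_eq_zero fun mk hmk => Set.indicator_of_notMem (h0 mk hmk) _, add_zero]
    by_cases hr : x ∈ record A n
    · rw [Set.indicator_of_mem hr, Set.indicator_of_mem (Set.mem_inter hr hs)]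
      congr 1
      refine le_antisymm ?_ (nonneg_of_mem_record hA hr)
      rcases n.eq_zero_or_pos with rfl | hn
      · rw [walk_zero]
      · simpa using hs n hn le_rfl
    · rw [Set.indicator_of_notMem hr,
        Set.indicator_of_notMem fun h : x ∈ record A n ∩ survival (Set.Ioi 0) n => hr h.1]
  · rw [Set.indicator_of_notMem
      fun h : x ∈ record A n ∩ survival (Set.Ioi 0) n => hs h.2, zero_add]
    obtain ⟨m, hm⟩ : ∃ m, x ∈ firstEntrance (Set.Ioi 0) m :=
      entranceTime_lt_top_iff.1 (lt_top_iff_ne_top.2 fun h => hs (mem_survival_iff.2 (by simp [h])))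
    have hmn : m ≤ n := by
      by_contra hc
      exact hs (mem_survival_iff.2 (by rw [mem_firstEntrance_iff.1 hm]; exact_mod_cast not_le.1 hc))
    rw [Finset.sum_eq_single_of_mem (m, n - m) (by simp [hmn]) ?_]
    · rw [Set.indicator_of_mem hm]
      have hrec : x ∈ record A n ↔ shift m x ∈ record A (n - m) := by
        constructor
        · intro h k hk
          have := h (m + k) (by omega)
          rw [walk_shift, walk_shift, show m + (n - m) = n by omega]
          simpa using this
        · intro h k hk
          rcases lt_or_ge k m with hkm | hkm
          · have h1 : walk coord k x ≤ 0 := by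
              rcases k.eq_zero_or_pos with rfl | hk0
              · rw [walk_zero]
              · simpa using hm.2.2 k hk0 hkm
            have h2 : 0 < walk coord m x := hm.2.1
            have h3 := nonneg_of_mem_record hA h
            rw [walk_shift, show m + (n - m) = n by omega] at h3
            rcases hA with rfl | rfl
            · simp only [Set.mem_Iio, not_lt]; linarith
            · simp only [Set.mem_Iic, not_le]; linarith
          · have := h (k - m) (by omega)
            rw [walk_shift, walk_shift, show m + (n - m) = n by omega,
              show m + (k - m) = k by omega] at this
            simpa using this
      by_cases hr : x ∈ record A n
      · rw [Set.indicator_of_mem hr, Set.indicator_of_mem (hrec.1 hr), walk_shift]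
        congr 1
        rw [show m + (n - m) = n by omega]
        ring
      · rw [Set.indicator_of_notMem hr, Set.indicator_of_notMem (mt hrec.2 hr)]
    · rintro ⟨j, k⟩ hjk hne
      refine Set.indicator_of_notMem (fun hj => hne ?_) _
      have : (j : ℕ∞) = m := (mem_firstEntrance_iff.1 hj).symm.trans (mem_firstEntrance_iff.1 hm)
      have hjm : j = m := by exact_mod_cast this
      rw [Finset.HasAntidiagonal.mem_antidiagonal] at hjk
      simp only at hjk
      simp only [Prod.mk.injEq]
      omega

lemma measurable_lintegral_record_add [IsProbabilityMeasure F]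
    {φ : ℝ → ℝ≥0∞} (hφ : Measurable φ) (n : ℕ) :
    Measurable fun v : ℝ => ∫⁻ y in record A n, φ (v + walk coord n y) ∂pathLaw F := by
  refine Measurable.lintegral_prod_right'
    (f := fun z : ℝ × (ℕ → ℝ) => φ (z.1 + walk coord n z.2)) ?_
  exact hφ.comp (measurable_fst.add ((measurable_walk_coord n).comp measurable_snd))

lemma measurable_renewalIntegral_add [IsProbabilityMeasure F]
    {φ : ℝ → ℝ≥0∞} (hφ : Measurable φ) :
    Measurable fun v : ℝ => renewalIntegral F A fun u => φ (v + u) :=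
  Measurable.tsum fun n => measurable_lintegral_record_add hφ n

/-- The integral against the (defective) ladder-height law, split over the ladder epoch. -/
lemma lintegral_ladderHeightLaw [IsProbabilityMeasure F] {ψ : ℝ → ℝ≥0∞} (hψ : Measurable ψ)
    (hp : pathLaw F {x | ladderEpoch coord x < ⊤} ≠ 0) :
    pathLaw F {x | ladderEpoch coord x < ⊤} * ∫⁻ v, ψ v ∂ladderHeightLaw (pathLaw F) coord
      = ∑' m, ∫⁻ x in firstEntrance (Set.Ioi 0) m, ψ (walk coord m x) ∂pathLaw F := by
  have hU : {x | ladderEpoch coord x < ⊤} = ⋃ m, firstEntrance (Set.Ioi (0 : ℝ)) m := by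
    ext x
    rw [Set.mem_iUnion]
    exact entranceTime_lt_top_iff
  have hdisj : Pairwise (Function.onFun Disjoint (firstEntrance (Set.Ioi (0 : ℝ)))) := by
    refine (pairwise_disjoint_on _).2 fun m n hmn => Set.disjoint_left.2 fun x hm hn => ?_
    have : (m : ℕ∞) = n := (mem_firstEntrance_iff.1 hm).symm.trans (mem_firstEntrance_iff.1 hn)
    exact hmn.ne (by exact_mod_cast this)
  have hmeas := measurableSet_firstEntrance (A := Set.Ioi (0 : ℝ)) measurableSet_Ioi
  have hE : Measurable fun x => walk coord (ladderEpoch coord x).toNat x :=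
    measurable_walk_entranceTime measurableSet_Ioi
  rw [ladderHeightLaw, lintegral_map hψ hE, ProbabilityTheory.cond, lintegral_smul_measure,
    smul_eq_mul, ← mul_assoc, ENNReal.mul_inv_cancel hp (measure_ne_top _ _), one_mul, hU,
    lintegral_iUnion hmeas hdisj]
  refine tsum_congr fun m => setLIntegral_congr_fun (hmeas m) fun x hx => ?_
  have : ladderEpoch coord x = m := mem_firstEntrance_iff.1 hx
  simp [this]

lemma lintegral_firstEntrance_shift [IsProbabilityMeasure F] (hA : MeasurableSet A)
    {φ : ℝ → ℝ≥0∞} (hφ : Measurable φ) (m k : ℕ) :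
    ∫⁻ x, (firstEntrance (Set.Ioi 0) m).indicator (fun x =>
          (record A k).indicator (fun y => φ (walk coord m x + walk coord k y))
            (shift m x)) x ∂pathLaw F
      = ∫⁻ x in firstEntrance (Set.Ioi 0) m,
          ∫⁻ y in record A k, φ (walk coord m x + walk coord k y) ∂pathLaw F ∂pathLaw F := by
  have hmeas := measurableSet_firstEntrance (A := Set.Ioi (0 : ℝ)) measurableSet_Ioi m
  have hrec := measurableSet_record hA k
  have hΦ : Measurable (Function.uncurry fun x y : ℕ → ℝ => (firstEntrance (Set.Ioi 0) m).indicator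
      (fun x => (record A k).indicator (fun y => φ (walk coord m x + walk coord k y)) y) x) := by
    have : (Function.uncurry fun x y : ℕ → ℝ => (firstEntrance (Set.Ioi 0) m).indicator
      (fun x => (record A k).indicator (fun y => φ (walk coord m x + walk coord k y)) y) x)
      = (firstEntrance (Set.Ioi 0) m ×ˢ record A k).indicator
          fun z => φ (walk coord m z.1 + walk coord k z.2) := by
      ext ⟨x, y⟩
      by_cases h1 : x ∈ firstEntrance (Set.Ioi 0) m <;> by_cases h2 : y ∈ record A k <;>
        simp [h1, h2]
    rw [this]
    exact Measurable.indicator (by fun_prop) (hmeas.prod hrec)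
  rw [← lintegral_indicator hmeas]
  refine (lintegral_markov m hΦ fun x y => ?_).trans ?_
  rotate_left
  · refine lintegral_congr fun x => ?_
    by_cases h1 : x ∈ firstEntrance (Set.Ioi 0) m
    · simp [h1, lintegral_indicator hrec]
    · simp [h1]
  · by_cases h : x ∈ firstEntrance (Set.Ioi 0) m
    · simp [h, stopAt_mem_firstEntrance_iff.2 h, walk_stopAt]
    · simp [h, mt stopAt_mem_firstEntrance_iff.1 h]

/-- The renewal equation for the ladder-height process. For weak ladder epochs the atom at `0` has
a mass that may exceed `1`: it counts the weak ladder epochs before the first strict one. -/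
lemma renewalIntegral_eq [IsProbabilityMeasure F] (hA : A = Set.Iio 0 ∨ A = Set.Iic 0)
    {φ : ℝ → ℝ≥0∞} (hφ : Measurable φ) (hp : pathLaw F {x | ladderEpoch coord x < ⊤} ≠ 0) :
    renewalIntegral F A φ
      = φ 0 * ∑' n, pathLaw F (record A n ∩ survival (Set.Ioi 0) n)
        + pathLaw F {x | ladderEpoch coord x < ⊤} *
          ∫⁻ v, renewalIntegral F A (fun u => φ (v + u)) ∂ladderHeightLaw (pathLaw F) coord := by
  have hm := measurableSet_of_halfLine hA
  have hrec := measurableSet_record hm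
  have hfst := measurableSet_firstEntrance (A := Set.Ioi (0 : ℝ)) measurableSet_Ioi
  have hint : ∀ n, MeasurableSet (record A n ∩ survival (Set.Ioi 0) n) := fun n =>
    (hrec n).inter (measurableSet_survival measurableSet_Ioi n)
  have hterm : ∀ m k, Measurable fun x => (firstEntrance (Set.Ioi 0) m).indicator (fun x =>
      (record A k).indicator (fun y => φ (walk coord m x + walk coord k y)) (shift m x)) x := by
    intro m k
    refine Measurable.indicator ?_ (hfst m)
    have : (fun x => (record A k).indicator (fun y => φ (walk coord m x + walk coord k y))
        (shift m x)) = (shift m ⁻¹' record A k).indicator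
          fun x => φ (walk coord m x + walk coord k (shift m x)) := by
      ext x
      by_cases h : shift m x ∈ record A k <;> simp [h]
    rw [this]
    exact Measurable.indicator (by fun_prop) (measurable_shift m (hrec k))
  have hn : ∀ n, ∫⁻ x in record A n, φ (walk coord n x) ∂pathLaw F
      = φ 0 * pathLaw F (record A n ∩ survival (Set.Ioi 0) n)
        + ∑ mk ∈ Finset.HasAntidiagonal.antidiagonal n, ∫⁻ x in firstEntrance (Set.Ioi 0) mk.1,
          ∫⁻ y in record A mk.2, φ (walk coord mk.1 x + walk coord mk.2 y) ∂pathLaw F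
            ∂pathLaw F := by
    intro n
    rw [← lintegral_indicator (hrec n), lintegral_congr (indicator_record_eq hA φ n),
      lintegral_add_left (measurable_const.indicator (hint n)),
      lintegral_indicator_const (hint n), lintegral_finsetSum _ fun mk _ => hterm mk.1 mk.2]
    congr 1
    exact Finset.sum_congr rfl fun mk _ => lintegral_firstEntrance_shift hm hφ mk.1 mk.2
  rw [lintegral_ladderHeightLaw (measurable_renewalIntegral_add hφ) hp]
  simp only [renewalIntegral]
  rw [tsum_congr hn, ENNReal.tsum_add, ENNReal.tsum_mul_left]
  congr 1
  set f : ℕ × ℕ → ℝ≥0∞ := fun mk => ∫⁻ x in firstEntrance (Set.Ioi 0) mk.1,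
    ∫⁻ y in record A mk.2, φ (walk coord mk.1 x + walk coord mk.2 y) ∂pathLaw F ∂pathLaw F with hf
  calc ∑' n, ∑ mk ∈ Finset.HasAntidiagonal.antidiagonal n, f mk
      = ∑' n, ∑' mk : Finset.HasAntidiagonal.antidiagonal n, f mk :=
        tsum_congr fun n => (Finset.tsum_subtype (Finset.HasAntidiagonal.antidiagonal n) f).symm
    _ = ∑' z : Σ n : ℕ, Finset.HasAntidiagonal.antidiagonal n, f z.2 :=
        (ENNReal.tsum_sigma' fun z : Σ n : ℕ, Finset.HasAntidiagonal.antidiagonal n => f z.2).symm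
    _ = ∑' mk, f mk := Finset.HasAntidiagonal.sigmaAntidiagonalEquivProd.tsum_eq f
    _ = ∑' m, ∑' k, f (m, k) := ENNReal.tsum_prod'
    _ = _ := tsum_congr fun m => by
        refine (lintegral_tsum (μ := (pathLaw F).restrict (firstEntrance (Set.Ioi 0) m))
          (f := fun k x => ∫⁻ y in record A k,
          φ (walk coord m x + walk coord k y) ∂pathLaw F) fun k => ?_).symm
        exact ((measurable_lintegral_record_add hφ k).comp (measurable_walk_coord m)).aemeasurable

end Renewal

/-! ### Subsolutions of the renewal equation -/

section RenewalBound

variable {G : Measure ℝ} {f h : ℝ → ℝ}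

lemma integrableOn_antitone_sub [IsProbabilityMeasure G] (hf : Antitone f) (x : ℝ) :
    IntegrableOn (fun v => f (x - v)) (Set.Icc 0 x) G := by
  have hmono : Monotone fun v => f (x - v) := fun u v huv => hf (by linarith)
  exact (hmono.monotoneOn _).integrableOn_isCompact isCompact_Icc

/-- If `∫_{[0,x]} f(x - v) G(dv) ∼ f(x)` for a positive antitone `f`, then the part of the integral
near the end point `x` is negligible. The reason is that the part near `0` alone already exhausts
`f(x)`, as `f` is antitone and `G` is a probability measure on `[0, ∞)`. -/
lemma eventually_setIntegral_Ioc_le [IsProbabilityMeasure G] (hG : G (Set.Iio 0) = 0)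
    (hf : Antitone f) (hpos : ∀ x, 0 < f x)
    (hI : (fun x => ∫ v in Set.Icc 0 x, f (x - v) ∂G) ~[atTop] f) {c δ : ℝ} (hc : 0 ≤ c)
    (hδ : 0 < δ) :
    ∀ᶠ x in atTop, ∫ v in Set.Ioc (x - c) x, f (x - v) ∂G ≤ δ * f x := by
  obtain ⟨y, hy0, hy⟩ : ∃ y, 0 ≤ y ∧ 1 - δ / 2 < G.real (Set.Icc 0 y) := by
    have h1 : Tendsto (fun y => G.real (Set.Iic y)) atTop (𝓝 (G.real Set.univ)) :=
      (ENNReal.tendsto_toReal (measure_ne_top _ _)).comp (tendsto_measure_Iic_atTop G)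
    rw [probReal_univ] at h1
    obtain ⟨y, hy1, hy0⟩ := ((h1.eventually (lt_mem_nhds (show 1 - δ / 2 < 1 by linarith))).and
      (eventually_ge_atTop 0)).exists
    refine ⟨y, hy0, hy1.trans_le ?_⟩
    have hsub : Set.Iic y ⊆ Set.Iio 0 ∪ Set.Icc 0 y := fun z hz => by
      rcases lt_or_ge z 0 with h | h
      · exact .inl h
      · exact .inr ⟨h, hz⟩
    refine (measureReal_mono hsub).trans ((measureReal_union_le _ _).trans ?_)
    simp [measureReal_def, hG]
  filter_upwards [hI.isLittleO.def (half_pos hδ), eventually_ge_atTop (y + c + 1)] with x hx hxy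
  have hint := integrableOn_antitone_sub (G := G) hf x
  have hs1 : Set.Icc 0 y ⊆ Set.Icc 0 x := Set.Icc_subset_Icc le_rfl (by linarith)
  have hs2 : Set.Ioc (x - c) x ⊆ Set.Icc 0 x := fun z hz => ⟨by linarith [hz.1], hz.2⟩
  have hdisj : Disjoint (Set.Icc 0 y) (Set.Ioc (x - c) x) :=
    Set.disjoint_left.2 fun z hz hz' => by linarith [hz.2, hz'.1]
  have hle : ∫ v in Set.Icc 0 y ∪ Set.Ioc (x - c) x, f (x - v) ∂G
      ≤ ∫ v in Set.Icc 0 x, f (x - v) ∂G :=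
    setIntegral_mono_set hint (ae_of_all _ fun v => (hpos _).le)
      (Set.union_subset hs1 hs2).eventuallyLE
  rw [setIntegral_union hdisj measurableSet_Ioc (hint.mono_set hs1) (hint.mono_set hs2)] at hle
  have hlow : G.real (Set.Icc 0 y) * f x ≤ ∫ v in Set.Icc 0 y, f (x - v) ∂G := by
    rw [← smul_eq_mul, ← setIntegral_const]
    exact setIntegral_mono_on (integrableOn_const (measure_ne_top _ _)) (hint.mono_set hs1)
      measurableSet_Icc fun v hv => hf (by linarith [hv.1])
  simp only [Pi.sub_apply, Real.norm_eq_abs, abs_of_pos (hpos x)] at hx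
  have h1 := (abs_le.1 hx).2
  have h2 := mul_le_mul_of_nonneg_right hy.le (hpos x).le
  linarith

lemma eventually_setIntegral_Icc_le (hpos : ∀ x, 0 < f x)
    (hI : (fun x => ∫ v in Set.Icc 0 x, f (x - v) ∂G) ~[atTop] f) {δ : ℝ} (hδ : 0 < δ) :
    ∀ᶠ x in atTop, ∫ v in Set.Icc 0 x, f (x - v) ∂G ≤ (1 + δ) * f x := by
  filter_upwards [hI.isLittleO.def hδ] with x hx
  simp only [Pi.sub_apply, Real.norm_eq_abs, abs_of_pos (hpos x)] at hx
  linarith [(abs_le.1 hx).2]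

variable {p κ m : ℝ}

/-- A bounded subsolution of the renewal equation is bounded by a multiple of `f`: beyond some `x₀`
the equation contracts the supremum of `h / f` over `[0, X]`, uniformly in `X`. -/
lemma exists_forall_le_mul [IsProbabilityMeasure G] (hf : Antitone f) (hpos : ∀ x, 0 < f x)
    (hI : (fun x => ∫ v in Set.Icc 0 x, f (x - v) ∂G) ~[atTop] f)
    (hp0 : 0 ≤ p) (hp1 : p < 1) (hh0 : ∀ x, 0 ≤ h x) (hhm : ∀ x, h x ≤ m)
    (hren : ∀ x, 0 ≤ x → ∀ g : ℝ → ℝ, IntegrableOn g (Set.Icc 0 x) G →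
      (∀ v ∈ Set.Icc 0 x, h (x - v) ≤ g v) → h x ≤ κ * f x + p * ∫ v in Set.Icc 0 x, g v ∂G) :
    ∃ R, 0 ≤ R ∧ ∀ x, 0 ≤ x → h x ≤ R * f x := by
  have hm : 0 ≤ m := (hh0 0).trans (hhm 0)
  set δ := (1 - p) / 2 with hδ
  have hδ0 : 0 < δ := by linarith
  have hq : p * (1 + δ) < 1 := by nlinarith
  obtain ⟨x₀, hx₀⟩ := eventually_atTop.1 (eventually_setIntegral_Icc_le hpos hI hδ0)
  set R := max (m / f x₀) (κ / (1 - p * (1 + δ))) with hR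
  refine ⟨R, (div_nonneg hm (hpos _).le).trans (le_max_left _ _), fun X hX => ?_⟩
  set S := (fun x => h x / f x) '' Set.Icc 0 X with hS
  have hbdd : BddAbove S := by
    refine ⟨m / f X, ?_⟩
    rintro _ ⟨x, hx, rfl⟩
    exact div_le_div₀ hm (hhm x) (hpos X) (hf hx.2)
  have hK : ∀ x ∈ Set.Icc 0 X, h x ≤ sSup S * f x := fun x hx =>
    (div_le_iff₀ (hpos x)).1 (le_csSup hbdd ⟨x, hx, rfl⟩)
  have hK0 : 0 ≤ sSup S := (div_nonneg (hh0 X) (hpos X).le).trans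
    (le_csSup hbdd ⟨X, ⟨hX, le_rfl⟩, rfl⟩)
  have hstep : sSup S ≤ max (m / f x₀) (κ + p * (1 + δ) * sSup S) := by
    refine csSup_le ⟨_, X, ⟨hX, le_rfl⟩, rfl⟩ ?_
    rintro _ ⟨x, hx, rfl⟩
    rcases le_total x x₀ with h1 | h1
    · exact le_max_of_le_left (div_le_div₀ hm (hhm x) (hpos _) (hf h1))
    · refine le_max_of_le_right ((div_le_iff₀ (hpos x)).2 ?_)
      have h2 := hren x hx.1 (fun v => sSup S * f (x - v))
        ((integrableOn_antitone_sub hf x).const_mul _)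
        fun v hv => hK _ ⟨by linarith [hv.2], by linarith [hv.1, hx.2]⟩
      rw [integral_const_mul] at h2
      have h3 := mul_le_mul_of_nonneg_left (hx₀ x h1) (mul_nonneg hp0 hK0)
      linarith
  have hfin : sSup S ≤ R := by
    rcases le_max_iff.1 hstep with h1 | h1
    · exact h1.trans (le_max_left _ _)
    · refine le_trans ?_ (le_max_right _ _)
      rw [le_div_iff₀ (by linarith)]
      linarith
  exact (hK X ⟨hX, le_rfl⟩).trans (mul_le_mul_of_nonneg_right hfin (hpos X).le)

/-- One use of the renewal equation improves an asymptotic bound `h ≤ a f` to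
`h ≤ (κ + p a + δ) f`. -/
lemma eventually_le_mul_step [IsProbabilityMeasure G] (hG : G (Set.Iio 0) = 0)
    (hf : Antitone f) (hpos : ∀ x, 0 < f x)
    (hI : (fun x => ∫ v in Set.Icc 0 x, f (x - v) ∂G) ~[atTop] f) (hp0 : 0 ≤ p) (hp1 : p < 1)
    (hren : ∀ x, 0 ≤ x → ∀ g : ℝ → ℝ, IntegrableOn g (Set.Icc 0 x) G →
      (∀ v ∈ Set.Icc 0 x, h (x - v) ≤ g v) → h x ≤ κ * f x + p * ∫ v in Set.Icc 0 x, g v ∂G)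
    {R a δ : ℝ} (hR : 0 ≤ R) (hhR : ∀ x, 0 ≤ x → h x ≤ R * f x) (ha : 0 ≤ a)
    (hha : ∀ᶠ x in atTop, h x ≤ a * f x) (hδ : 0 < δ) :
    ∀ᶠ x in atTop, h x ≤ (κ + p * a + δ) * f x := by
  obtain ⟨y, hy0, hy⟩ : ∃ y, 0 ≤ y ∧ ∀ x, y ≤ x → h x ≤ a * f x := by
    obtain ⟨y, hy⟩ := eventually_atTop.1 hha
    exact ⟨max y 0, le_max_right _ _, fun x hx => hy x ((le_max_left _ _).trans hx)⟩
  set ε := δ / (a + R + 1) with hε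
  have hε0 : 0 < ε := by positivity
  have hεδ : (a + R) * ε ≤ δ := by
    have : (a + R + 1) * ε = δ := by rw [hε]; field_simp
    linarith
  filter_upwards [eventually_setIntegral_Icc_le hpos hI hε0,
    eventually_setIntegral_Ioc_le hG hf hpos hI hy0 hε0, eventually_ge_atTop y] with x h1 h2 hxy
  have hint := integrableOn_antitone_sub (G := G) hf x
  have hsub : Set.Ioc (x - y) x ⊆ Set.Icc 0 x := fun z hz => ⟨by linarith [hz.1], hz.2⟩
  have hint2 : IntegrableOn ((Set.Ioc (x - y) x).indicator fun v => f (x - v)) (Set.Icc 0 x) G :=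
    hint.indicator measurableSet_Ioc
  have h3 := hren x (hy0.trans hxy)
    (fun v => a * f (x - v) + R * (Set.Ioc (x - y) x).indicator (fun v => f (x - v)) v)
    ((hint.const_mul a).add (hint2.const_mul R)) ?_
  · rw [integral_add (hint.const_mul a) (hint2.const_mul R), integral_const_mul,
      integral_const_mul, setIntegral_indicator measurableSet_Ioc,
      Set.inter_eq_self_of_subset_right hsub] at h3
    set I := ∫ v in Set.Icc 0 x, f (x - v) ∂G
    set J := ∫ v in Set.Ioc (x - y) x, f (x - v) ∂G
    have h4 : a * I + R * J ≤ (a + δ) * f x := by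
      have := mul_le_mul_of_nonneg_left h1 ha
      have := mul_le_mul_of_nonneg_left h2 hR
      have := mul_le_mul_of_nonneg_right hεδ (hpos x).le
      linarith
    have h5 := mul_le_mul_of_nonneg_left h4 hp0
    have h6 : p * (δ * f x) ≤ 1 * (δ * f x) :=
      mul_le_mul_of_nonneg_right hp1.le (mul_nonneg hδ.le (hpos x).le)
    linarith
  · intro v hv
    by_cases hvy : v ≤ x - y
    · rw [Set.indicator_of_notMem fun hc => hc.1.not_ge hvy]
      simpa using hy (x - v) (by linarith)
    · rw [Set.indicator_of_mem (show v ∈ Set.Ioc (x - y) x from ⟨not_le.1 hvy, hv.2⟩)]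
      have := hhR (x - v) (by linarith [hv.2])
      have := mul_nonneg ha (hpos (x - v)).le
      linarith

/-- A bounded subsolution of the renewal equation with forcing term `(1 - p) m f` is asymptotically
at most `m f`: the infimum `L` of the asymptotic bounds satisfies `L ≤ (1 - p) m + p L`. -/
lemma eventually_le_mul_of_renewal [IsProbabilityMeasure G] (hG : G (Set.Iio 0) = 0)
    (hf : Antitone f) (hpos : ∀ x, 0 < f x) (hI : (fun x => ∫ v in Set.Icc 0 x, f (x - v) ∂G) ~[atTop] f)
    (hp0 : 0 ≤ p) (hp1 : p < 1) (hh0 : ∀ x, 0 ≤ h x) (hhm : ∀ x, h x ≤ m)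
    (hren : ∀ x, 0 ≤ x → ∀ g : ℝ → ℝ, IntegrableOn g (Set.Icc 0 x) G →
      (∀ v ∈ Set.Icc 0 x, h (x - v) ≤ g v) →
        h x ≤ (1 - p) * m * f x + p * ∫ v in Set.Icc 0 x, g v ∂G)
    {ε : ℝ} (hε : 0 < ε) : ∀ᶠ x in atTop, h x ≤ (m + ε) * f x := by
  obtain ⟨R, hR0, hR⟩ := exists_forall_le_mul hf hpos hI hp0 hp1 hh0 hhm hren
  have hm : 0 ≤ m := (hh0 0).trans (hhm 0)
  set T := {a : ℝ | 0 ≤ a ∧ ∀ᶠ x in atTop, h x ≤ a * f x} with hT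
  have hTbdd : BddBelow T := ⟨0, fun a ha => ha.1⟩
  have hTne : T.Nonempty := ⟨R, hR0, by
    filter_upwards [eventually_ge_atTop 0] with x hx using hR x hx⟩
  have hstep : ∀ a ∈ T, sInf T ≤ (1 - p) * m + p * a := fun a ha =>
    le_of_forall_pos_le_add fun δ hδ => csInf_le hTbdd
      ⟨by have := mul_nonneg (sub_nonneg.2 hp1.le) hm; have := mul_nonneg hp0 ha.1; linarith,
        eventually_le_mul_step hG hf hpos hI hp0 hp1 hren hR0 hR ha.1 ha.2 hδ⟩
  have hL : sInf T ≤ (1 - p) * m + p * sInf T :=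
    le_of_forall_pos_le_add fun δ hδ => by
      obtain ⟨a, ha, haL⟩ := exists_lt_of_csInf_lt hTne (lt_add_of_pos_right (sInf T) hδ)
      have h1 := hstep a ha
      have h2 := mul_le_mul_of_nonneg_left haL.le hp0
      have h3 := mul_le_mul_of_nonneg_right hp1.le hδ.le
      linarith
  have hLm : sInf T < m + ε := by
    have : (1 - p) * sInf T ≤ (1 - p) * m := by linarith
    linarith [le_of_mul_le_mul_left this (by linarith)]
  obtain ⟨a, ha, ham⟩ := exists_lt_of_csInf_lt hTne hLm
  filter_upwards [ha.2] with x hx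
  exact hx.trans (mul_le_mul_of_nonneg_right ham.le (hpos x).le)

end RenewalBound

/-! ### The maximum up to the entrance time -/

section Maximum

variable {F : Measure ℝ} {A : Set ℝ}

/-- The next step exceeds a level determined by the past. -/
lemma measure_inter_lt_step [IsProbabilityMeasure F] {n : ℕ} {D : Set (ℕ → ℝ)}
    (hD : MeasurableSet D) (hDn : ∀ x, stopAt n x ∈ D ↔ x ∈ D) {a : (ℕ → ℝ) → ℝ}
    (ha : Measurable a) (han : ∀ x, a (stopAt n x) = a x) :
    pathLaw F (D ∩ {x | a x < x n}) = ∫⁻ x in D, F (Set.Ioi (a x)) ∂pathLaw F := by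
  classical
  have hmeas : MeasurableSet {z : (ℕ → ℝ) × (ℕ → ℝ) | z.1 ∈ D ∧ a z.1 < z.2 0} :=
    (measurable_fst hD).inter (measurableSet_lt (ha.comp measurable_fst)
      ((measurable_pi_apply 0).comp measurable_snd))
  have h := lintegral_markov (F := F) n
    (Φ := fun x y => {z : (ℕ → ℝ) × (ℕ → ℝ) | z.1 ∈ D ∧ a z.1 < z.2 0}.indicator 1 (x, y))
    (measurable_one.indicator hmeas) (fun x y => by simp [Set.indicator_apply, hDn, han])
  have hl : MeasurableSet (D ∩ {x | a x < x n}) :=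
    hD.inter (measurableSet_lt ha (measurable_pi_apply n))
  rw [← lintegral_indicator_one hl, ← lintegral_indicator hD]
  refine Eq.trans (lintegral_congr fun x => ?_) (h.trans (lintegral_congr fun x => ?_))
  · simp [Set.indicator_apply, shift]
  · by_cases hx : x ∈ D
    · have h0 : MeasurableSet {y : ℕ → ℝ | a x < y 0} :=
        measurableSet_lt measurable_const (measurable_pi_apply 0)
      have : ∀ y : ℕ → ℝ, {z : (ℕ → ℝ) × (ℕ → ℝ) | z.1 ∈ D ∧ a z.1 < z.2 0}.indicator
          (1 : (ℕ → ℝ) × (ℕ → ℝ) → ℝ≥0∞) (x, y) =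
            {y : ℕ → ℝ | a x < y 0}.indicator 1 y := fun y => by
        simp [Set.indicator_apply, hx]
      simp only [this, lintegral_indicator_one h0, hx, Set.indicator_of_mem]
      conv_rhs => rw [← map_eval_pathLaw (F := F) 0]
      rw [Measure.map_apply (measurable_pi_apply 0) measurableSet_Ioi]
      rfl
    · simp [hx]

lemma nonneg_of_mem_survival (hA : A = Set.Iio 0 ∨ A = Set.Iic 0) {n : ℕ} {x : ℕ → ℝ}
    (hx : x ∈ survival A n) : 0 ≤ walk coord n x := by
  rcases n.eq_zero_or_pos with rfl | hn
  · rw [walk_zero]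
  · have := hx n hn le_rfl
    rcases hA with rfl | rfl
    · simpa using this
    · exact (not_le.1 this).le

/-- The lower bound: the walk may exceed `x` by a single big step, taken from a nonnegative position
before the entrance into `A`. -/
lemma eventually_mul_le_measure_lt_maxUpTo [IsProbabilityMeasure F]
    (hA : A = Set.Iio 0 ∨ A = Set.Iic 0) {c : ℝ≥0∞}
    (hc : c < meanTime (pathLaw F) (entranceTime coord A)) :
    ∀ᶠ x : ℝ in atTop, c * F (Set.Ioi x)
      ≤ pathLaw F {y | (x : EReal) < maxUpTo coord (entranceTime coord A) y} := by
  have hm := measurableSet_of_halfLine hA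
  rw [meanTime_entranceTime hm, ENNReal.tsum_eq_iSup_nat] at hc
  obtain ⟨N, hN⟩ := lt_iSup_iff.1 hc
  set D : ℕ → ℝ → Set (ℕ → ℝ) := fun n x => survival A n ∩ {y | ∀ k ≤ n, walk coord k y ≤ x}
  have hDm : ∀ n x, MeasurableSet (D n x) := fun n x => by
    refine (measurableSet_survival hm n).inter ?_
    simp only [Set.ofPred_forall]
    exact .iInter fun k => .iInter fun _ =>
      measurableSet_le (measurable_walk_coord k) measurable_const
  have hlim : Tendsto (fun x => ∑ n ∈ Finset.range N, pathLaw F (D n x)) atTop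
      (𝓝 (∑ n ∈ Finset.range N, pathLaw F (survival A n))) := by
    refine tendsto_finsetSum _ fun n _ => ?_
    have hmono : Monotone (D n) := fun x y hxy z hz =>
      ⟨hz.1, fun k hk => (hz.2 k hk).trans hxy⟩
    have hU : ⋃ x, D n x = survival A n := by
      refine Set.Subset.antisymm (Set.iUnion_subset fun x => Set.inter_subset_left) fun y hy => ?_
      obtain ⟨x, hx⟩ := ((Finset.range (n + 1)).image fun k => walk coord k y).bddAbove
      exact Set.mem_iUnion.2 ⟨x, hy, fun k hk => hx (by
        simpa using ⟨k, by omega, rfl⟩)⟩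
    rw [← hU]
    exact tendsto_measure_iUnion_atTop hmono
  filter_upwards [hlim.eventually (lt_mem_nhds hN)] with x hx
  set E : ℕ → Set (ℕ → ℝ) := fun n => D n x ∩ {y | x < y n}
  have hjump : ∀ n, ∀ y ∈ E n, x < walk coord (n + 1) y := fun n y hy => by
    rw [walk_succ]
    have h1 := nonneg_of_mem_survival hA hy.1.1
    have h2 : x < coord n y := hy.2
    linarith
  have hdisj : Pairwise (Function.onFun Disjoint E) := by
    refine (pairwise_disjoint_on _).2 fun m n hmn => Set.disjoint_left.2 fun y hm hn => ?_
    exact (hjump m y hm).not_ge (hn.1.2 (m + 1) hmn)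
  have hEm : ∀ n, MeasurableSet (E n) := fun n =>
    (hDm n x).inter (measurableSet_lt measurable_const (measurable_pi_apply n))
  have hE : ∀ n, pathLaw F (E n) = pathLaw F (D n x) * F (Set.Ioi x) := fun n => by
    rw [measure_inter_lt_step (hDm n x) (fun y => ?_) measurable_const (fun _ => rfl)]
    · simp [mul_comm]
    · refine and_congr stopAt_mem_survival_iff (forall₂_congr fun k hk => ?_)
      rw [walk_stopAt hk]
  calc c * F (Set.Ioi x)
      ≤ (∑ n ∈ Finset.range N, pathLaw F (D n x)) * F (Set.Ioi x) := by gcongr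
    _ = ∑ n ∈ Finset.range N, pathLaw F (E n) := by simp only [Finset.sum_mul, hE]
    _ = pathLaw F (⋃ n ∈ Finset.range N, E n) :=
        (measure_biUnion_finset (fun m _ n _ hmn => hdisj hmn) fun n _ => hEm n).symm
    _ ≤ _ := measure_mono <| Set.iUnion₂_subset fun n _ y hy => by
        refine lt_maxUpTo_iff.2 ⟨n + 1, ?_, hjump n y hy⟩
        exact_mod_cast Order.add_one_le_of_lt (mem_survival_iff.1 hy.1.1)

/-- The tail of `F` beyond `x` as seen from the position `u`, restricted to `u ≤ x`. -/
noncomputable def overshoot (F : Measure ℝ) (x u : ℝ) : ℝ≥0∞ :=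
  (Set.Iic x).indicator (fun u => F (Set.Ioi (x - u))) u

lemma measurable_overshoot (x : ℝ) : Measurable (overshoot F x) := by
  refine Measurable.indicator ?_ measurableSet_Iic
  exact Monotone.measurable fun u v huv => measure_mono (Set.Ioi_subset_Ioi (by linarith))

lemma overshoot_le_one [IsProbabilityMeasure F] (x u : ℝ) : overshoot F x u ≤ 1 :=
  Set.indicator_le (s := Set.Iic x) (g := fun _ => 1) (fun _ _ => prob_le_one) u

lemma overshoot_add (x v : ℝ) :
    (fun u => overshoot F x (v + u)) = overshoot F (x - v) := by
  ext u
  simp only [overshoot, Set.indicator_apply, Set.mem_Iic, le_sub_iff_add_le', sub_sub]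

/-- The upper bound: the first passage above `x` happens by a step from some position `u ≤ x`
reached before the entrance into `A`. -/
lemma measure_lt_maxUpTo_le [IsProbabilityMeasure F] (hA : A = Set.Iio 0 ∨ A = Set.Iic 0) {x : ℝ}
    (hx : 0 ≤ x) :
    pathLaw F {y | (x : EReal) < maxUpTo coord (entranceTime coord A) y}
      ≤ renewalIntegral F A (overshoot F x) := by
  classical
  have hm := measurableSet_of_halfLine hA
  have hsub : {y | (x : EReal) < maxUpTo coord (entranceTime coord A) y} ⊆
      ⋃ n, (survival A n ∩ {y | walk coord n y ≤ x}) ∩ {y | x - walk coord n y < y n} := by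
    intro y hy
    have hex := lt_maxUpTo_iff.1 hy
    obtain ⟨hk, hkx⟩ := Nat.find_spec hex
    have hmin : ∀ j, j < Nat.find hex →
        ¬((j : ℕ∞) ≤ entranceTime coord A y ∧ x < walk coord j y) := fun j => Nat.find_min hex
    generalize Nat.find hex = k at hk hkx hmin
    cases k with
    | zero => rw [walk_zero] at hkx; exact absurd hx hkx.not_ge
    | succ n =>
      have hn : (n : ℕ∞) < entranceTime coord A y :=
        lt_of_lt_of_le (by exact_mod_cast n.lt_succ_self) hk
      have h1 : walk coord n y ≤ x := by
        by_contra hc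
        exact hmin n n.lt_succ_self ⟨hn.le, not_le.1 hc⟩
      refine Set.mem_iUnion.2 ⟨n, ⟨mem_survival_iff.2 hn, h1⟩, ?_⟩
      rw [walk_succ] at hkx
      exact sub_lt_iff_lt_add'.2 hkx
  have hD : ∀ n, MeasurableSet {y | walk coord n y ≤ x} := fun n =>
    measurableSet_le (measurable_walk_coord n) measurable_const
  rw [← tsum_lintegral_survival hm (measurable_overshoot x)]
  refine (measure_mono hsub).trans ((measure_iUnion_le _).trans (ENNReal.tsum_le_tsum fun n => ?_))
  rw [measure_inter_lt_step ((measurableSet_survival hm n).inter (hD n)) (fun y => ?_)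
    (by fun_prop) (fun y => by rw [walk_stopAt le_rfl]), Set.inter_comm,
    ← Measure.restrict_restrict (hD n), ← lintegral_indicator (hD n)]
  · rfl
  · exact and_congr stopAt_mem_survival_iff (by simp [walk_stopAt])

lemma renewalIntegral_overshoot_of_neg (hA : A = Set.Iio 0 ∨ A = Set.Iic 0) {x : ℝ} (hx : x < 0) :
    renewalIntegral F A (overshoot F x) = 0 := by
  refine ENNReal.tsum_eq_zero.2 fun n => ?_
  rw [← lintegral_zero]
  refine setLIntegral_congr_fun (measurableSet_record (measurableSet_of_halfLine hA) n)
    fun y hy => ?_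
  have h : walk coord n y ∉ Set.Iic x := not_le.2 (hx.trans_le (nonneg_of_mem_record hA hy))
  simp [overshoot, h]

end Maximum

/-! ### The asymptotics on the path space -/

section Asymptotics

variable {F : Measure ℝ} {A : Set ℝ}

lemma prob_ladderEpoch_ne_zero
    [hG : IsProbabilityMeasure (ladderHeightLaw (pathLaw F) coord)] :
    pathLaw F {x | ladderEpoch coord x < ⊤} ≠ 0 := by
  intro h0
  have h1 : ladderHeightLaw (pathLaw F) coord = 0 := by
    rw [ladderHeightLaw, cond_eq_zero_of_meas_eq_zero h0, Measure.map_zero]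
  have h2 := hG.measure_univ
  simp [h1] at h2

lemma renewalIntegral_overshoot_le [IsProbabilityMeasure F] (x : ℝ) :
    renewalIntegral F A (overshoot F x) ≤ renewalIntegral F A fun _ => 1 :=
  ENNReal.tsum_le_tsum fun _ => lintegral_mono fun _ => overshoot_le_one _ _

/-- The renewal equation for the integrated overshoot tails. Its forcing term is `(1 - p) m F̄(x)`,
since the total mass `m` satisfies the same equation with constant forcing term. -/
lemma renewalIntegral_overshoot_toReal_le [IsProbabilityMeasure F]
    (hA : A = Set.Iio 0 ∨ A = Set.Iic 0)
    (hdrift : ∀ᵐ x ∂pathLaw F, Tendsto (fun n => walk coord n x) atTop atBot)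
    [hG : IsProbabilityMeasure (ladderHeightLaw (pathLaw F) coord)]
    {x : ℝ} (hx : 0 ≤ x) {g : ℝ → ℝ}
    (hG0 : ladderHeightLaw (pathLaw F) coord (Set.Iio 0) = 0)
    (hg : IntegrableOn g (Set.Icc 0 x) (ladderHeightLaw (pathLaw F) coord))
    (hle : ∀ v ∈ Set.Icc 0 x, (renewalIntegral F A (overshoot F (x - v))).toReal ≤ g v) :
    (renewalIntegral F A (overshoot F x)).toReal
      ≤ (1 - (pathLaw F {x | ladderEpoch coord x < ⊤}).toReal)
          * (renewalIntegral F A fun _ => 1).toReal * tail F x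
        + (pathLaw F {x | ladderEpoch coord x < ⊤}).toReal
          * ∫ v in Set.Icc 0 x, g v ∂ladderHeightLaw (pathLaw F) coord := by
  set G := ladderHeightLaw (pathLaw F) coord with hGdef
  set p := pathLaw F {x | ladderEpoch coord x < ⊤} with hp
  have hp0 : p ≠ 0 := prob_ladderEpoch_ne_zero
  have hpt : p ≠ ⊤ := measure_ne_top _ _
  set κ := ∑' n, pathLaw F (record A n ∩ survival (Set.Ioi 0) n) with hκ
  set m := renewalIntegral F A (fun _ => 1) with hm
  have hmt : m ≠ ⊤ := renewalIntegral_one_ne_top hA hdrift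
  have hfin : ∀ y, renewalIntegral F A (overshoot F y) ≠ ⊤ := fun y =>
    ((renewalIntegral_overshoot_le y).trans_lt hmt.lt_top).ne
  have hmass : m = κ + p * m := by
    have h := renewalIntegral_eq (F := F) hA (φ := fun _ => 1) measurable_const hp0
    simpa [← hm, ← hκ, ← hp, ← hGdef] using h
  have hκt : κ ≠ ⊤ := fun h => hmt (by rw [hmass, h, top_add])
  have hκm : κ.toReal = (1 - p.toReal) * m.toReal := by
    have h := congrArg ENNReal.toReal hmass
    rw [ENNReal.toReal_add hκt (ENNReal.mul_ne_top hpt hmt), ENNReal.toReal_mul] at h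
    linarith
  have hsub : ∫⁻ v, renewalIntegral F A (overshoot F (x - v)) ∂G
      ≤ ENNReal.ofReal (∫ v in Set.Icc 0 x, g v ∂G) := by
    have hsupp : ∀ᵐ v ∂G, renewalIntegral F A (overshoot F (x - v))
        = (Set.Icc 0 x).indicator (fun v => renewalIntegral F A (overshoot F (x - v))) v := by
      have h0 : ∀ᵐ v ∂G, v ∉ Set.Iio 0 := measure_eq_zero_iff_ae_notMem.1 hG0
      filter_upwards [h0] with v hv
      rcases le_or_gt v x with h | h
      · rw [Set.indicator_of_mem (show v ∈ Set.Icc 0 x from ⟨not_lt.1 hv, h⟩)]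
      · rw [Set.indicator_of_notMem fun hc => hc.2.not_gt h,
          renewalIntegral_overshoot_of_neg hA (by linarith)]
    rw [lintegral_congr_ae hsupp, lintegral_indicator measurableSet_Icc,
      ofReal_integral_eq_lintegral_ofReal hg]
    · refine setLIntegral_mono' measurableSet_Icc fun v hv => ?_
      rw [← ENNReal.ofReal_toReal (hfin (x - v))]
      exact ENNReal.ofReal_le_ofReal (hle v hv)
    · exact (ae_restrict_iff' measurableSet_Icc).2 (ae_of_all _ fun v hv =>
        ENNReal.toReal_nonneg.trans (hle v hv))
  have hg0 : 0 ≤ ∫ v in Set.Icc 0 x, g v ∂G :=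
    setIntegral_nonneg measurableSet_Icc fun v hv => ENNReal.toReal_nonneg.trans (hle v hv)
  have heq := renewalIntegral_eq (F := F) hA (measurable_overshoot (F := F) x) hp0
  simp only [overshoot_add] at heq
  have h0 : overshoot F x 0 = F (Set.Ioi x) := by simp [overshoot, hx]
  rw [h0] at heq
  have hle' : renewalIntegral F A (overshoot F x)
      ≤ F (Set.Ioi x) * κ + p * ENNReal.ofReal (∫ v in Set.Icc 0 x, g v ∂G) := by
    rw [heq]
    gcongr
  have h1 : F (Set.Ioi x) * κ ≠ ⊤ := ENNReal.mul_ne_top (measure_ne_top _ _) hκt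
  have h2 : p * ENNReal.ofReal (∫ v in Set.Icc 0 x, g v ∂G) ≠ ⊤ :=
    ENNReal.mul_ne_top hpt ENNReal.ofReal_ne_top
  have := ENNReal.toReal_mono (ENNReal.add_ne_top.2 ⟨h1, h2⟩) hle'
  rw [ENNReal.toReal_add h1 h2, ENNReal.toReal_mul, ENNReal.toReal_mul, ENNReal.toReal_ofReal hg0,
    hκm, mul_comm] at this
  exact this

/-- The asymptotic equivalence on the path space: the single-big-jump lower bound meets the upper
bound obtained from the renewal equation. -/
lemma isEquivalent_measure_lt_maxUpTo [IsProbabilityMeasure F]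
    (hA : A = Set.Iio 0 ∨ A = Set.Iic 0)
    (hdrift : ∀ᵐ x ∂pathLaw F, Tendsto (fun n => walk coord n x) atTop atBot)
    (hSF : MemSF F (ladderHeightLaw (pathLaw F) coord)) :
    (fun x : ℝ => (pathLaw F).real {y | (x : EReal) < maxUpTo coord (entranceTime coord A) y})
      ~[atTop] fun x : ℝ =>
        (meanTime (pathLaw F) (entranceTime coord A)).toReal * tail F x := by
  have hG := hSF.isProbabilityMeasure
  have hmeas := measurableSet_of_halfLine hA
  have hmt := renewalIntegral_one_ne_top hA hdrift
  have hlow := fun c => eventually_mul_le_measure_lt_maxUpTo (F := F) hA (c := c)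
  simp only [meanTime_eq_renewalIntegral hmeas] at hlow ⊢
  set m := renewalIntegral F A (fun _ => 1) with hm
  have hm0 : m ≠ 0 := fun h => by
    have := tsum_record_mul_stay hA hdrift
    rw [← renewalIntegral_one, ← hm, h, zero_mul] at this
    exact zero_ne_one this
  have hmpos : 0 < m.toReal := ENNReal.toReal_pos hm0 hmt
  have hp1 : (pathLaw F {x | ladderEpoch coord x < ⊤}).toReal < 1 := by
    have := (ENNReal.toReal_lt_toReal (measure_ne_top _ _) ENNReal.one_ne_top).2
      (prob_ladderEpoch_lt_one hdrift)
    simpa using this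
  have hanti : Antitone (tail F) := fun x y hxy =>
    measureReal_mono (Set.Ioi_subset_Ioi hxy)
  refine Asymptotics.isLittleO_iff.2 fun c hc => ?_
  have hup := eventually_le_mul_of_renewal (h := fun x =>
    (renewalIntegral F A (overshoot F x)).toReal) (m := m.toReal) hSF.nonneg hanti hSF.tail_pos
    hSF.isEquivalent ENNReal.toReal_nonneg hp1 (fun _ => ENNReal.toReal_nonneg)
    (fun x => ENNReal.toReal_mono hmt (renewalIntegral_overshoot_le x))
    (fun x hx g hg hle => renewalIntegral_overshoot_toReal_le hA hdrift hx hSF.nonneg hg hle)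
    (mul_pos hc hmpos)
  have hc' : ENNReal.ofReal ((1 - c) * m.toReal) < m := by
    rw [← ENNReal.ofReal_toReal hmt, ENNReal.ofReal_lt_ofReal_iff hmpos,
      ENNReal.toReal_ofReal hmpos.le]
    nlinarith
  filter_upwards [hup, hlow _ hc', eventually_ge_atTop 0] with x h1 h2 h3
  have hupper := ENNReal.toReal_mono
    ((renewalIntegral_overshoot_le x).trans_lt hmt.lt_top).ne (measure_lt_maxUpTo_le (F := F) hA h3)
  have hlower := ENNReal.toReal_mono (measure_ne_top _ _) h2
  rw [ENNReal.toReal_mul] at hlower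
  have hc_le : (1 - c) * m.toReal ≤ (ENNReal.ofReal ((1 - c) * m.toReal)).toReal := by
    rw [ENNReal.toReal_ofReal']
    exact le_max_left _ _
  have hlower' := (mul_le_mul_of_nonneg_right hc_le (hSF.tail_pos x).le).trans hlower
  have hpos := mul_pos hmpos (hSF.tail_pos x)
  rw [Pi.sub_apply, Real.norm_eq_abs, Real.norm_eq_abs, abs_of_pos hpos, abs_le]
  simp only [measureReal_def]
  constructor <;> linarith

end Asymptotics

/-! ### Transfer to an arbitrary probability space -/

section Transfer

variable {Ω : Type*} [MeasurableSpace Ω] {P : Measure Ω} {ξ : ℕ → Ω → ℝ}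

lemma measurableSet_lt_maxUpTo {A : Set ℝ} (hA : MeasurableSet A) (x : ℝ) :
    MeasurableSet {y | (x : EReal) < maxUpTo coord (entranceTime coord A) y} := by
  simp only [lt_maxUpTo_iff, Set.ofPred_exists]
  exact .iUnion fun i => (measurable_entranceTime hA (.of_discrete (s := Set.Ici (i : ℕ∞)))).inter
    (measurableSet_lt measurable_const (measurable_walk_coord i))

lemma ladderHeightLaw_map {π : Ω → ℕ → ℝ} (hπ : Measurable π) (hξ : ∀ ω i, π ω i = ξ i ω) :
    ladderHeightLaw (P.map π) coord = ladderHeightLaw P ξ := by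
  obtain rfl : ξ = fun i ω => π ω i := by ext i ω; exact (hξ ω i).symm
  have hE : Measurable fun x => walk coord (ladderEpoch coord x).toNat x :=
    measurable_walk_entranceTime measurableSet_Ioi
  have hset : MeasurableSet {x : ℕ → ℝ | ladderEpoch coord x < ⊤} :=
    measurable_entranceTime measurableSet_Ioi (.of_discrete (s := Set.Iio ⊤))
  rw [ladderHeightLaw, ProbabilityTheory.cond, Measure.restrict_map hπ hset,
    Measure.map_apply hπ hset, ← Measure.map_smul, Measure.map_map hE hπ]
  rfl

end Transfer

end RandomWalk

theorem lemma3p1 {Ω : Type*} [MeasurableSpace Ω] (P : Measure Ω) [IsProbabilityMeasure P]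
    (F : Measure ℝ) (ξ : ℕ → Ω → ℝ) (hmeas : ∀ n, Measurable (ξ n))
    (hindep : iIndepFun ξ P) (hlaw : ∀ n, P.map (ξ n) = F)
    -- the entrance set of `τ`: both conventions `S_n < 0` and `S_n ≤ 0` are covered
    (A : Set ℝ) (hA : A = Set.Iio 0 ∨ A = Set.Iic 0)
    (τ : Ω → ℕ∞) (hτ : τ = RandomWalk.entranceTime ξ A) :
    -- lower bound, without any assumption on `F` or on the ladder heights
    (∀ c : ℝ≥0∞, c < RandomWalk.meanTime P τ →
      ∀ᶠ x : ℝ in atTop,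
        c * F (Set.Ioi x) ≤ P {ω | (x : EReal) < RandomWalk.maxUpTo ξ τ ω}) ∧
    -- the asymptotics, for a walk drifting to `-∞` whose ladder-height law is in `S_F`
    ((∀ᵐ ω ∂P, Tendsto (fun n => RandomWalk.walk ξ n ω) atTop atBot) →
      RandomWalk.MemSF F (RandomWalk.ladderHeightLaw P ξ) →
      RandomWalk.meanTime P τ < ⊤ ∧
      (fun x : ℝ => P.real {ω | (x : EReal) < RandomWalk.maxUpTo ξ τ ω}) ~[atTop]
        (fun x : ℝ => (RandomWalk.meanTime P τ).toReal * RandomWalk.tail F x)) := by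
  have hA' := RandomWalk.measurableSet_of_halfLine hA
  have hF : IsProbabilityMeasure F :=
    hlaw 0 ▸ Measure.isProbabilityMeasure_map (hmeas 0).aemeasurable
  set π : Ω → ℕ → ℝ := fun ω i => ξ i ω with hπdef
  have hπ : Measurable π := measurable_pi_iff.2 hmeas
  have hlawπ : P.map π = RandomWalk.pathLaw F := by
    rw [hπdef, hindep.map_fun_eq_infinitePi_map hmeas, RandomWalk.pathLaw]
    simp only [hlaw]
  have hmean : RandomWalk.meanTime P τ
      = RandomWalk.meanTime (RandomWalk.pathLaw F)
        (RandomWalk.entranceTime RandomWalk.coord A) := by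
    rw [hτ, ← hlawπ, RandomWalk.meanTime, RandomWalk.meanTime, lintegral_map _ hπ]
    · rfl
    · exact (measurable_of_countable _).comp (RandomWalk.measurable_entranceTime hA')
  have hmax : ∀ x : ℝ, P {ω | (x : EReal) < RandomWalk.maxUpTo ξ τ ω}
      = RandomWalk.pathLaw F {y | (x : EReal) < RandomWalk.maxUpTo RandomWalk.coord
        (RandomWalk.entranceTime RandomWalk.coord A) y} := fun x => by
    rw [hτ, ← hlawπ, Measure.map_apply hπ (RandomWalk.measurableSet_lt_maxUpTo hA' x)]
    rfl
  simp only [measureReal_def, hmean, hmax]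
  refine ⟨fun c hc => RandomWalk.eventually_mul_le_measure_lt_maxUpTo hA hc, fun hdrift hSF => ?_⟩
  have hdrift' : ∀ᵐ x ∂(RandomWalk.pathLaw F),
      Tendsto (fun n => RandomWalk.walk RandomWalk.coord n x) atTop atBot := by
    rw [← hlawπ, ae_map_iff hπ.aemeasurable
      (measurableSet_tendsto atBot RandomWalk.measurable_walk_coord)]
    exact hdrift
  rw [← RandomWalk.ladderHeightLaw_map hπ fun _ _ => rfl, hlawπ] at hSF
  refine ⟨?_, RandomWalk.isEquivalent_measure_lt_maxUpTo hA hdrift' hSF⟩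
  rw [RandomWalk.meanTime_eq_renewalIntegral hA']
  exact (RandomWalk.renewalIntegral_one_ne_top hA hdrift').lt_top
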